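/- Let $F(G)$ denote the Fibonacci index of a finite simple graph $G$, i.e. the number of its stable (independent) sets, the empty set included. For integers $1\le \alpha\le n-1$ let $T_c(n,\alpha)$ be the Turán-connected graph: take the disjoint union of $\alpha$ cliques on $n$ vertices in total whose orders differ by at most one, choose a vertex $v$ in a clique of order $\lceil n/\alpha\rceil$, and join $v$ to exactly one vertex of each of the other $\alpha-1$ cliques (this graph is unique up to isomorphism). Let $G$ be a tree of order $n\ge 2$ with stability number $\alpha$. Then $n/2\le\alpha\le n-1$ and $$F(G)\le 3^{\,n-\alpha-1}\,2^{\,2\alpha-n+1}+2^{\,n-\alpha-1},$$ with equality if and only if $G\simeq T_c(n,\alpha)$. Moreover, for all integers $n\ge 2$ and $\alpha$ with $n/2\le\alpha\le n-1$, the graph $T_c(n,\alpha)$ is the spider consisting of a central vertex with $\alpha$ legs attached, of which $n-\alpha-1$ have length $2$ and $2\alpha-n+1$ have length $1$. -/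

import Mathlib

/-- The Fibonacci index of a graph: the number of its stable (independent) sets, the empty set
included. -/
noncomputable def fibonacciIndex {V : Type*} (G : SimpleGraph V) : ℕ :=
  Nat.card {s : Finset V // G.IsIndepSet (s : Set V)}

/-- The graph `T(n, a)`: the disjoint union of `a` balanced cliques on `n` vertices. The cliques are
the residue classes modulo `a`. Mathlib's `SimpleGraph.turanGraph n a` is its complement. -/
def turanCliques (n a : ℕ) : SimpleGraph (Fin n) :=
  (SimpleGraph.turanGraph n a)ᶜ

/-- The graph `T_c(n, a)`, for `1 ≤ a ≤ n - 1`: the vertex `0`, which lies in a clique of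
`T(n, a)` of the largest size `⌈n / a⌉`, is linked to one vertex of each of the other `a - 1`
cliques, namely to the vertices `1, …, a - 1`. -/
def turanConnected (n a : ℕ) : SimpleGraph (Fin n) :=
  turanCliques n a ⊔ SimpleGraph.fromRel (fun v w => v.val = 0 ∧ w.val < a)

/-- The spider with `k` legs, the `i`-th one of length `l i`: the center is `none`, and the leg `i`
is a path `some ⟨i, 0⟩, some ⟨i, 1⟩, …, some ⟨i, l i - 1⟩` whose first vertex is linked to the
center. -/
def spider {k : ℕ} (l : Fin k → ℕ) : SimpleGraph (Option (Σ i : Fin k, Fin (l i))) :=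
  SimpleGraph.fromRel fun u v =>
    (u = none ∧ ∃ i, ∃ j : Fin (l i), v = some ⟨i, j⟩ ∧ j.val = 0) ∨
    (∃ i, ∃ j j' : Fin (l i), u = some ⟨i, j⟩ ∧ v = some ⟨i, j'⟩ ∧ j'.val = j.val + 1)

/-!
Let `G` be a tree with `n` vertices and stability number `α`, and put `m = n - α - 1`.

Trees are bipartite, so Hall's theorem matches the `m + 1` vertices outside a maximum independent
set into that set (`exists_matching_into_indepSet`). Since `G` is connected, its vertex set can be
built up from one edge of this matching by attaching, one at a time, the other `m` edges of the
matching and the `s = n - 2 m - 2` unmatched vertices, each new piece being joined to a vertex `u`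
already present (`Assembly`, `exists_assembly_univ`).

Let `i(S)` be the number of independent subsets of such a set `S`. Only the attached vertices and
edges matter for upper bounds: `i(S) ≤ 3 ^ (m + 1) * 2 ^ s`, and `i(S \ {u}) ≤ 3 ^ m * 2 ^ (s + 1)`
for every `u ∈ S`, with equality only if every vertex of `S`, respectively `S \ {u}`, has at most
one neighbor there (`Assembly.indepCount_erase_le`). Attaching a vertex at `u` adds at most
`i(S \ {u})` independent sets, and attaching an edge at `u` adds at most `i(S) + i(S \ {u})`.
By induction `i(S) ≤ 3 ^ m * 2 ^ (s + 1) + 2 ^ m` (`Assembly.indepCount_le_add`). Equality in the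
last step alone makes `S \ {u}` extremal, so in an extremal tree there is a vertex `u` without
which all degrees are at most one: the tree is a spider with center `u` and legs of length one or
two (`exists_iso_leggedStar`), and the power of three in `i(S \ {u})` counts the legs of length two.

Such a spider is determined up to isomorphism by the numbers of its first and second leg vertices
(`nonempty_leggedStar_iso`). Both `turanConnected n α` and the spider of the theorem are of this
form, with `α` first and `m` second leg vertices, and `fibonacciIndex_leggedStar` counts their
independent sets.
-/

open Finset

/-! ### Counting independent sets inside a vertex set -/

section Counting

variable {V : Type*} (G : SimpleGraph V)

open Classical in
/-- The number of independent sets of `G` contained in `S`. -/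
noncomputable def indepCount (S : Finset V) : ℕ :=
  #(S.powerset.filter fun t : Finset V => G.IsIndepSet (t : Set V))

lemma fibonacciIndex_eq_indepCount_univ [Fintype V] :
    fibonacciIndex G = indepCount G univ := by
  classical
  simp [fibonacciIndex, indepCount, Nat.card_eq_fintype_card, Fintype.card_subtype]

@[simp] lemma indepCount_empty : indepCount G ∅ = 1 := by
  classical
  simp [indepCount, Finset.filter_singleton, SimpleGraph.IsIndepSet]

lemma indepCount_mono {S T : Finset V} (h : S ⊆ T) : indepCount G S ≤ indepCount G T := by
  classical
  exact card_le_card (filter_subset_filter _ (powerset_mono.2 h))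

lemma eq_of_indepCount_le {S T : Finset V} (h : S ⊆ T) (hc : indepCount G T ≤ indepCount G S) :
    S = T := by
  classical
  have := eq_of_subset_of_card_le
    (filter_subset_filter (fun t : Finset V => G.IsIndepSet (t : Set V)) (powerset_mono.2 h)) hc
  refine h.antisymm fun x hx => ?_
  have hx' : ({x} : Finset V) ∈ T.powerset.filter fun t : Finset V => G.IsIndepSet (t : Set V) := by
    simp [hx, SimpleGraph.IsIndepSet]
  rw [← this] at hx'
  simpa using (mem_filter.1 hx').1

lemma indepCount_map {W : Type*} {H : SimpleGraph W} (f : G ↪g H)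
    (S : Finset V) : indepCount H (S.map f.toEmbedding) = indepCount G S := by
  classical
  symm
  refine card_bij (fun t _ => t.map f.toEmbedding) ?_ ?_ ?_
  · intro t ht
    simp only [mem_filter, mem_powerset] at ht ⊢
    refine ⟨map_subset_map.2 ht.1, ?_⟩
    rintro _ hx _ hy hxy
    simp only [coe_map, Set.mem_image, mem_coe] at hx hy
    obtain ⟨x, hx, rfl⟩ := hx
    obtain ⟨y, hy, rfl⟩ := hy
    have := ht.2 hx hy (fun h => hxy (h ▸ rfl))
    simpa using this
  · intro t _ t' _ h
    exact map_injective _ h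
  · intro t ht
    simp only [mem_filter, mem_powerset] at ht
    obtain ⟨t', ht', rfl⟩ := subset_map_iff.1 ht.1
    refine ⟨t', ?_, rfl⟩
    simp only [mem_filter, mem_powerset]
    refine ⟨ht', fun x hx y hy hxy => ?_⟩
    have := ht.2 (mem_coe.2 (mem_map_of_mem f.toEmbedding hx))
      (mem_coe.2 (mem_map_of_mem f.toEmbedding hy)) (f.injective.ne hxy)
    simpa using this

lemma fibonacciIndex_congr [Fintype V] {W : Type*} [Fintype W] {H : SimpleGraph W}
    (f : G ≃g H) : fibonacciIndex G = fibonacciIndex H := by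
  classical
  rw [fibonacciIndex_eq_indepCount_univ, fibonacciIndex_eq_indepCount_univ,
    ← indepCount_map G f.toEmbedding]
  congr 1
  exact map_univ_equiv f.toEquiv

variable [DecidableEq V]

open Classical in
/-- An independent subset of `insert x S` either avoids `x`, or is `x` together with an independent
set of non-neighbours of `x`. -/
lemma indepCount_insert {S : Finset V} {x : V} (hx : x ∉ S) :
    indepCount G (insert x S) = indepCount G S + indepCount G {v ∈ S | ¬ G.Adj x v} := by
  rw [indepCount, powerset_insert, filter_union, card_union_of_disjoint]
  · congr 1
    symm
    refine card_bij (fun t _ => insert x t) ?_ ?_ ?_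
    · intro t ht
      simp only [mem_filter, mem_powerset] at ht
      simp only [mem_filter, mem_image, mem_powerset]
      refine ⟨⟨t, fun v hv => (mem_filter.1 (ht.1 hv)).1, rfl⟩, ?_⟩
      rw [coe_insert, SimpleGraph.IsIndepSet, Set.pairwise_insert]
      refine ⟨ht.2, fun b hb _ => ?_⟩
      have := (mem_filter.1 (ht.1 hb)).2
      exact ⟨this, fun h => this h.symm⟩
    · intro t ht t' ht' h
      simp only [mem_filter, mem_powerset] at ht ht'
      have h1 : x ∉ t := fun h => hx (mem_filter.1 (ht.1 h)).1
      have h2 : x ∉ t' := fun h => hx (mem_filter.1 (ht'.1 h)).1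
      rw [← erase_insert h1, h, erase_insert h2]
    · intro t ht
      simp only [mem_filter, mem_image, mem_powerset] at ht
      obtain ⟨⟨t', ht', rfl⟩, hi⟩ := ht
      rw [coe_insert, SimpleGraph.IsIndepSet, Set.pairwise_insert] at hi
      refine ⟨t', ?_, rfl⟩
      simp only [mem_filter, mem_powerset]
      refine ⟨fun v hv => mem_filter.2 ⟨ht' hv, ?_⟩, hi.1⟩
      exact (hi.2 v hv (fun h => hx (h ▸ ht' hv))).1
  · rw [disjoint_left]
    intro t ht ht'
    simp only [mem_filter, mem_image, mem_powerset] at ht ht'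
    obtain ⟨⟨t', _, rfl⟩, _⟩ := ht'
    exact hx (ht.1 (mem_insert_self _ _))

lemma indepCount_insert_le {S : Finset V} {x : V} (hx : x ∉ S) :
    indepCount G (insert x S) ≤ 2 * indepCount G S := by
  classical
  rw [indepCount_insert G hx, two_mul]
  gcongr
  exact indepCount_mono G (filter_subset _ _)

lemma not_adj_of_indepCount_insert {S : Finset V} {x : V} (hx : x ∉ S)
    (h : 2 * indepCount G S ≤ indepCount G (insert x S)) : ∀ v ∈ S, ¬ G.Adj x v := by
  classical
  rw [indepCount_insert G hx] at h
  exact filter_eq_self.1 (eq_of_indepCount_le G (filter_subset _ _) (by omega))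

lemma indepCount_insert_of_not_adj {S : Finset V} {x : V} (hx : x ∉ S)
    (h : ∀ v ∈ S, ¬ G.Adj x v) : indepCount G (insert x S) = 2 * indepCount G S := by
  classical
  rw [indepCount_insert G hx, filter_true_of_mem h, two_mul]

open Classical in
/-- When `x` and `y` are adjacent, an independent set contains neither, only `x`, or only `y`. -/
lemma indepCount_insert_insert {S : Finset V} {x y : V} (hx : x ∉ S) (hy : y ∉ S)
    (hxy : G.Adj x y) :
    indepCount G (insert x (insert y S)) =
      indepCount G S + indepCount G {v ∈ S | ¬ G.Adj y v} + indepCount G {v ∈ S | ¬ G.Adj x v} := by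
  rw [indepCount_insert G (x := x) (by simp [hx, hxy.ne]), indepCount_insert G hy,
    filter_insert, if_neg (by simpa using hxy)]

lemma indepCount_insert_insert_le {S : Finset V} {x y : V} (hx : x ∉ S) (hy : y ∉ S)
    (hxy : G.Adj x y) : indepCount G (insert x (insert y S)) ≤ 3 * indepCount G S := by
  classical
  rw [indepCount_insert_insert G hx hy hxy]
  have h1 := indepCount_mono G (filter_subset (fun v => ¬ G.Adj x v) S)
  have h2 := indepCount_mono G (filter_subset (fun v => ¬ G.Adj y v) S)
  omega

lemma not_adj_of_indepCount_insert_insert {S : Finset V} {x y : V} (hx : x ∉ S) (hy : y ∉ S)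
    (hxy : G.Adj x y) (h : 3 * indepCount G S ≤ indepCount G (insert x (insert y S))) :
    ∀ v ∈ S, ¬ G.Adj x v ∧ ¬ G.Adj y v := by
  classical
  rw [indepCount_insert_insert G hx hy hxy] at h
  have h1 := indepCount_mono G (filter_subset (fun v => ¬ G.Adj x v) S)
  have h2 := indepCount_mono G (filter_subset (fun v => ¬ G.Adj y v) S)
  intro v hv
  exact ⟨filter_eq_self.1
      (eq_of_indepCount_le G (filter_subset (fun v => ¬ G.Adj x v) S) (by omega)) v hv,
    filter_eq_self.1
      (eq_of_indepCount_le G (filter_subset (fun v => ¬ G.Adj y v) S) (by omega)) v hv⟩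

lemma indepCount_insert_insert_of_not_adj {S : Finset V} {x y : V} (hx : x ∉ S) (hy : y ∉ S)
    (hxy : G.Adj x y) (h : ∀ v ∈ S, ¬ G.Adj x v ∧ ¬ G.Adj y v) :
    indepCount G (insert x (insert y S)) = 3 * indepCount G S := by
  classical
  rw [indepCount_insert_insert G hx hy hxy, filter_true_of_mem fun v hv => (h v hv).1,
    filter_true_of_mem fun v hv => (h v hv).2]
  ring

end Counting

/-! ### Bounds for graphs built up by attaching vertices and edges -/

section Assembly

variable {V : Type*} [DecidableEq V] (G : SimpleGraph V)

/-- Every vertex of `S` has at most one neighbour in `S`. -/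
def SparseOn (S : Finset V) : Prop :=
  ∀ v ∈ S, ∀ w ∈ S, ∀ w' ∈ S, G.Adj v w → G.Adj v w' → w = w'

/-- `Assembly G S m s` says that `S` arises from the two ends of an edge of `G` by attaching `s`
times a vertex and `m` times an edge, where the new vertex, respectively one end of the new edge, is
adjacent to some vertex already present. -/
inductive Assembly : Finset V → ℕ → ℕ → Prop
  | base {a b : V} (h : G.Adj a b) : Assembly {a, b} 0 0
  | single {S : Finset V} {m s : ℕ} {u x : V} (hS : Assembly S m s) (hu : u ∈ S) (hx : x ∉ S)
      (hux : G.Adj u x) : Assembly (insert x S) m (s + 1)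
  | pair {S : Finset V} {m s : ℕ} {u x y : V} (hS : Assembly S m s) (hu : u ∈ S) (hx : x ∉ S)
      (hy : y ∉ S) (hux : G.Adj u x) (hxy : G.Adj x y) :
      Assembly (insert x (insert y S)) (m + 1) s

variable {G}

lemma SparseOn.insert_vertex {S : Finset V} {x : V} (hS : SparseOn G S)
    (h : ∀ v ∈ S, ¬ G.Adj x v) : SparseOn G (insert x S) := by
  intro v hv w hw w' hw' h1 h2
  have h' : ∀ v ∈ S, ¬ G.Adj v x := fun v hv h1 => h v hv h1.symm
  simp only [mem_insert] at hv hw hw'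
  have := G.irrefl (v := x)
  rcases hv with rfl | hv <;> rcases hw with rfl | hw <;> rcases hw' with rfl | hw' <;>
    first
    | rfl
    | exact hS v hv w hw w' hw' h1 h2
    | (exfalso; simp_all)

lemma SparseOn.insert_edge {S : Finset V} {x y : V} (hS : SparseOn G S)
    (h : ∀ v ∈ S, ¬ G.Adj x v ∧ ¬ G.Adj y v) : SparseOn G (insert x (insert y S)) := by
  have h' : ∀ v ∈ S, ¬ G.Adj v x ∧ ¬ G.Adj v y :=
    fun v hv => ⟨fun h1 => (h v hv).1 h1.symm, fun h1 => (h v hv).2 h1.symm⟩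
  intro v hv w hw w' hw' h1 h2
  simp only [mem_insert] at hv hw hw'
  have hx := G.irrefl (v := x)
  have hy := G.irrefl (v := y)
  rcases hv with rfl | rfl | hv <;> rcases hw with rfl | rfl | hw <;>
    rcases hw' with rfl | rfl | hw' <;>
    first
    | rfl
    | exact hS v hv w hw w' hw' h1 h2
    | (exfalso; simp_all)

/-- Discarding all edges except those of the pieces, an assembly consists of `m + 1` edges and `s`
isolated vertices; discarding an edge strictly increases the number of independent sets. -/
lemma Assembly.indepCount_le {S : Finset V} {m s : ℕ} (hS : Assembly G S m s) :
    indepCount G S ≤ 3 ^ (m + 1) * 2 ^ s ∧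
      (indepCount G S = 3 ^ (m + 1) * 2 ^ s → SparseOn G S) := by
  induction hS with
  | @base a b h =>
    have h3 := indepCount_insert_insert_of_not_adj G (S := ∅) (notMem_empty _) (notMem_empty _) h
      (by simp)
    have h0 : SparseOn G (∅ : Finset V) := by simp [SparseOn]
    have := h0.insert_edge (x := a) (y := b) (by simp)
    simp only [insert_empty_eq, indepCount_empty] at h3 this
    exact ⟨h3.le, fun _ => this⟩
  | @single S m s u x hS hu hx hux ih =>
    have h2 := indepCount_insert_le G hx
    have : 3 ^ (m + 1) * 2 ^ (s + 1) = 2 * (3 ^ (m + 1) * 2 ^ s) := by ring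
    refine ⟨by omega, fun h => ?_⟩
    exact (ih.2 (by omega)).insert_vertex (not_adj_of_indepCount_insert G hx (by omega))
  | @pair S m s u x y hS hu hx hy hux hxy ih =>
    have h2 := indepCount_insert_insert_le G hx hy hxy
    have : 3 ^ (m + 1 + 1) * 2 ^ s = 3 * (3 ^ (m + 1) * 2 ^ s) := by ring
    refine ⟨by omega, fun h => ?_⟩
    exact (ih.2 (by omega)).insert_edge
      (not_adj_of_indepCount_insert_insert G hx hy hxy (by omega))

/-- The bound after deletion of one vertex `u` of an assembly. If `u` was attached as a single
vertex, the rest satisfies the stronger bound of `Assembly.indepCount_le`. -/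
lemma Assembly.indepCount_erase_le {S : Finset V} {m s : ℕ} (hS : Assembly G S m s) {u : V}
    (hu : u ∈ S) :
    indepCount G (S.erase u) ≤ 3 ^ m * 2 ^ (s + 1) ∧
      (indepCount G (S.erase u) = 3 ^ m * 2 ^ (s + 1) → SparseOn G (S.erase u)) := by
  induction hS with
  | @base a b h =>
    have key (c : V) : indepCount G {c} = 2 ∧ SparseOn G {c} := by
      refine ⟨?_, by simp [SparseOn]⟩
      have := indepCount_insert_of_not_adj G (notMem_empty c) (by simp)
      simpa using this
    obtain ⟨c, hc⟩ : ∃ c, ({a, b} : Finset V).erase u = {c} := by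
      rw [← card_eq_one, card_erase_of_mem hu, card_pair h.ne]
    rw [hc]
    exact ⟨(key c).1.le, fun _ => (key c).2⟩
  | @single S m s v x hS hv hx hvx ih =>
    have e : 3 ^ m * 2 ^ (s + 1 + 1) = 2 * (3 ^ m * 2 ^ (s + 1)) := by ring
    by_cases hux : u = x
    · subst hux
      rw [erase_insert hx]
      have h1 := hS.indepCount_le.1
      have e' : 3 ^ (m + 1) * 2 ^ s = 3 * (3 ^ m * 2 ^ s) := by ring
      have e'' : 3 ^ m * 2 ^ (s + 1) = 2 * (3 ^ m * 2 ^ s) := by ring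
      have : 0 < 3 ^ m * 2 ^ s := by positivity
      exact ⟨by omega, fun h => by omega⟩
    · have hu' : u ∈ S := mem_of_mem_insert_of_ne hu hux
      have hx' : x ∉ S.erase u := fun h => hx (mem_of_mem_erase h)
      rw [erase_insert_of_ne (Ne.symm hux)]
      have h2 := indepCount_insert_le G hx'
      have ih := ih hu'
      refine ⟨by omega, fun h => ?_⟩
      exact (ih.2 (by omega)).insert_vertex (not_adj_of_indepCount_insert G hx' (by omega))
  | @pair S m s v x y hS hv hx hy hvx hxy ih =>
    have e : 3 ^ (m + 1) * 2 ^ (s + 1) = 3 * (3 ^ m * 2 ^ (s + 1)) := by ring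
    have e' : 3 ^ (m + 1) * 2 ^ (s + 1) = 2 * (3 ^ (m + 1) * 2 ^ s) := by ring
    -- Deleting an end of the new edge leaves `S` with the other end attached.
    have key {z : V} (hz : z ∉ S) :
        indepCount G (insert z S) ≤ 3 ^ (m + 1) * 2 ^ (s + 1) ∧
          (indepCount G (insert z S) = 3 ^ (m + 1) * 2 ^ (s + 1) → SparseOn G (insert z S)) := by
      have h2 := indepCount_insert_le G hz
      have h1 := hS.indepCount_le
      refine ⟨by omega, fun h => ?_⟩
      exact (h1.2 (by omega)).insert_vertex (not_adj_of_indepCount_insert G hz (by omega))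
    by_cases hux : u = x
    · subst hux
      rw [erase_insert (by simp [hx, hxy.ne])]
      exact key hy
    by_cases huy : u = y
    · subst huy
      rw [erase_insert_of_ne (Ne.symm hux), erase_insert hy]
      exact key hx
    · have hu' : u ∈ S := by simpa [hux, huy] using hu
      have hx' : x ∉ S.erase u := fun h => hx (mem_of_mem_erase h)
      have hy' : y ∉ S.erase u := fun h => hy (mem_of_mem_erase h)
      rw [erase_insert_of_ne (Ne.symm hux), erase_insert_of_ne (Ne.symm huy)]
      have h2 := indepCount_insert_insert_le G hx' hy' hxy
      have ih := ih hu'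
      refine ⟨by omega, fun h => ?_⟩
      exact (ih.2 (by omega)).insert_edge
        (not_adj_of_indepCount_insert_insert G hx' hy' hxy (by omega))

/-- The non-neighbours of `x` in `S` avoid `u`; if there are at least as many independent sets among
them as in `S.erase u`, then `u` is the only neighbour of `x` in `S`. -/
lemma indepCount_filter_not_adj_le {S : Finset V} {u x : V} [DecidablePred fun v => ¬ G.Adj x v]
    (hux : G.Adj u x) :
    indepCount G {v ∈ S | ¬ G.Adj x v} ≤ indepCount G (S.erase u) ∧
      (indepCount G (S.erase u) ≤ indepCount G {v ∈ S | ¬ G.Adj x v} →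
        ∀ v ∈ S.erase u, ¬ G.Adj x v) := by
  have hsub : {v ∈ S | ¬ G.Adj x v} ⊆ S.erase u := by
    intro v hv
    rw [mem_filter] at hv
    exact mem_erase.2 ⟨fun h => hv.2 (h ▸ hux.symm), hv.1⟩
  refine ⟨indepCount_mono G hsub, fun h v hv => ?_⟩
  rw [← eq_of_indepCount_le G hsub h] at hv
  exact (mem_filter.1 hv).2

/-- The bound on the number of independent sets of an assembly. In the last step, equality forces
the set without the vertex `u` of attachment to be extremal in `Assembly.indepCount_erase_le`, so
that `u` is the center. -/
theorem Assembly.indepCount_le_add {S : Finset V} {m s : ℕ} (hS : Assembly G S m s) :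
    indepCount G S ≤ 3 ^ m * 2 ^ (s + 1) + 2 ^ m ∧
      (indepCount G S = 3 ^ m * 2 ^ (s + 1) + 2 ^ m →
        ∃ u ∈ S, SparseOn G (S.erase u) ∧ indepCount G (S.erase u) = 3 ^ m * 2 ^ (s + 1)) := by
  classical
  induction hS with
  | @base a b h =>
    have hb := Assembly.base h
    have h3 := indepCount_insert_insert_of_not_adj G (S := ∅) (notMem_empty _) (notMem_empty _) h
      (by simp)
    have h2 := indepCount_insert_of_not_adj G (notMem_empty b) (by simp)
    simp only [insert_empty_eq, indepCount_empty] at h3 h2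
    have he : ({a, b} : Finset V).erase a = {b} := erase_insert (by simpa using h.ne)
    refine ⟨h3.le, fun _ => ⟨a, by simp, ?_⟩⟩
    rw [he]
    exact ⟨by simp [SparseOn], h2⟩
  | @single S m s u x hS hu hx hux ih =>
    have e : 3 ^ m * 2 ^ (s + 1 + 1) = 2 * (3 ^ m * 2 ^ (s + 1)) := by ring
    have h1 := indepCount_filter_not_adj_le (S := S) hux
    have h2 := hS.indepCount_erase_le hu
    have h3 := indepCount_insert G hx
    have hx' : x ∉ S.erase u := fun h => hx (mem_of_mem_erase h)
    refine ⟨by omega, fun h => ⟨u, mem_insert_of_mem hu, ?_⟩⟩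
    have h4 := h1.2 (by omega)
    rw [erase_insert_of_ne hux.ne']
    exact ⟨(h2.2 (by omega)).insert_vertex h4, by rw [indepCount_insert_of_not_adj G hx' h4]; omega⟩
  | @pair S m s u x y hS hu hx hy hux hxy ih =>
    have e : 3 ^ (m + 1) * 2 ^ (s + 1) = 3 * (3 ^ m * 2 ^ (s + 1)) := by ring
    have e' : 2 ^ (m + 1) = 2 * 2 ^ m := by ring
    have h1 := indepCount_filter_not_adj_le (S := S) hux
    have h2 := hS.indepCount_erase_le hu
    have h3 := indepCount_insert_insert G hx hy hxy
    have h5 := indepCount_mono G (filter_subset (fun v => ¬ G.Adj y v) S)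
    have hx' : x ∉ S.erase u := fun h => hx (mem_of_mem_erase h)
    have hy' : y ∉ S.erase u := fun h => hy (mem_of_mem_erase h)
    refine ⟨by omega, fun h => ⟨u, by simp [hu], ?_⟩⟩
    have h4 := h1.2 (by omega)
    have h6 := filter_eq_self.1 (eq_of_indepCount_le G
      (filter_subset (fun v => ¬ G.Adj y v) S) (by omega))
    have h7 : ∀ v ∈ S.erase u, ¬ G.Adj x v ∧ ¬ G.Adj y v :=
      fun v hv => ⟨h4 v hv, h6 v (mem_of_mem_erase hv)⟩
    rw [erase_insert_of_ne hux.ne', erase_insert_of_ne (ne_of_mem_of_not_mem hu hy).symm]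
    exact ⟨(h2.2 (by omega)).insert_edge h7,
      by rw [indepCount_insert_insert_of_not_adj G hx' hy' hxy h7]; omega⟩

end Assembly

/-! ### Matchings in bipartite graphs and assemblies of trees -/

section Matching

variable {V : Type*} [Fintype V] [DecidableEq V] {G : SimpleGraph V}

/-- In a bipartite graph the vertices outside a maximum independent set `I` can be matched into `I`.
Hall's condition is checked separately on each color class: if a set `X` of one color had fewer
neighbors in `I` than elements, exchanging these neighbors for `X` would enlarge `I`. -/
lemma exists_matching_into_indepSet (C : G.Coloring Bool) {I : Finset V}
    (hI : G.IsIndepSet (I : Set V)) (hmax : #I = G.indepNum) :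
    ∃ f : V → V, Set.InjOn f {v | v ∉ I} ∧ ∀ v ∉ I, f v ∈ I ∧ G.Adj v (f v) := by
  classical
  let t : {v // v ∉ I} → Finset V := fun v => {w ∈ I | G.Adj v w}
  have mono (k : Bool) (X : Finset {v // v ∉ I}) (hX : ∀ v ∈ X, C v = k) :
      #X ≤ #(X.biUnion t) := by
    have hind : G.IsIndepSet
        (((I \ X.biUnion t) ∪ X.map (Function.Embedding.subtype _) : Finset V) : Set V) := by
      have hcross : ∀ v ∈ I \ X.biUnion t, ∀ w : {v // v ∉ I}, w ∈ X → ¬ G.Adj w v := by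
        intro v hv w hw hadj
        rw [mem_sdiff] at hv
        exact hv.2 (mem_biUnion.2 ⟨w, hw, mem_filter.2 ⟨hv.1, hadj⟩⟩)
      intro a ha b hb hab hadj
      simp only [coe_union, Set.mem_union, mem_coe, mem_map,
        Function.Embedding.subtype_apply] at ha hb
      rcases ha with ha | ⟨a, ha, rfl⟩ <;> rcases hb with hb | ⟨b, hb, rfl⟩
      · exact hI (mem_sdiff.1 ha).1 (mem_sdiff.1 hb).1 hab hadj
      · exact hcross a ha b hb hadj.symm
      · exact hcross b hb a ha hadj
      · exact C.valid hadj ((hX a ha).trans (hX b hb).symm)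
    have hcard := hind.card_le_indepNum
    rw [← hmax, card_union_of_disjoint, card_map] at hcard
    · have hsub : X.biUnion t ⊆ I := biUnion_subset.2 fun v _ => filter_subset _ _
      have := card_sdiff_add_card_eq_card hsub
      omega
    · rw [disjoint_left]
      intro a ha ha'
      obtain ⟨v, _, rfl⟩ := mem_map.1 ha'
      exact v.2 (mem_sdiff.1 ha).1
  have hall : ∀ X : Finset {v // v ∉ I}, #X ≤ #(X.biUnion t) := by
    intro X
    have hsplit : X.biUnion t =
        (X.filter fun v : {v // v ∉ I} => C v = true).biUnion t ∪
          (X.filter fun v : {v // v ∉ I} => ¬ C v = true).biUnion t := by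
      rw [← union_biUnion, filter_union_filter_not_eq]
    rw [hsplit, card_union_of_disjoint,
      ← card_filter_add_card_filter_not (s := X) (fun v => C v = true)]
    · refine add_le_add (mono true _ fun v hv => (mem_filter.1 hv).2) (mono false _ fun v hv => ?_)
      simpa using (mem_filter.1 hv).2
    · rw [disjoint_left]
      intro w h1 h2
      simp only [mem_biUnion, mem_filter, t] at h1 h2
      obtain ⟨a, ⟨_, ha⟩, _, hwa⟩ := h1
      obtain ⟨b, ⟨_, hb⟩, _, hwb⟩ := h2
      have h1 := C.valid hwa
      have h2 := C.valid hwb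
      rw [ha] at h1
      rw [Bool.not_eq_true] at hb
      rw [hb] at h2
      cases h : C w <;> simp_all
  obtain ⟨f, hf, hft⟩ := (all_card_le_biUnion_card_iff_exists_injective t).1 hall
  refine ⟨fun v => if h : v ∉ I then f ⟨v, h⟩ else v, ?_, ?_⟩
  · intro a ha b hb hab
    simp only [Set.mem_ofPred_eq] at ha hb
    simp only [ha, hb, not_false_eq_true, dite_true] at hab
    simpa using hf hab
  · intro v hv
    simp only [hv, not_false_eq_true, dite_true]
    exact mem_filter.1 (hft ⟨v, hv⟩)

/-- A connected graph with a matching `f` of the complement of an independent set `I` into `I` is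
assembled from one edge of the matching by attaching the other edges of the matching and the
unmatched vertices. -/
lemma exists_assembly_univ (hG : G.Connected) {I : Finset V} {f : V → V}
    (hinj : Set.InjOn f {v | v ∉ I}) (hf : ∀ v ∉ I, f v ∈ I ∧ G.Adj v (f v))
    (hne : ∃ v, v ∉ I) :
    ∃ m s, Assembly G univ m s ∧ #(univ.filter fun v => v ∉ I) = m + 1 ∧
      Fintype.card V = 2 * m + 2 + s := by
  classical
  -- A largest assembly closed under the matching is everything.
  let P : Finset V → Prop := fun S => ∃ m s, Assembly G S m s ∧
    #(S.filter fun v => v ∉ I) = m + 1 ∧ #S = 2 * m + 2 + s ∧ ∀ v ∉ I, v ∈ S ↔ f v ∈ S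
  have hbase : ∃ S, P S := by
    obtain ⟨v, hv⟩ := hne
    refine ⟨{v, f v}, 0, 0, .base (hf v hv).2, ?_, ?_, ?_⟩
    · rw [filter_insert, if_pos hv, filter_singleton, if_neg (by simpa using (hf v hv).1)]
      simp
    · rw [card_pair (hf v hv).2.ne]
    · intro w hw
      have h1 : w ≠ f v := fun h => hw (h ▸ (hf v hv).1)
      have h2 : f w ≠ v := fun h => hv (h ▸ (hf w hw).1)
      have h3 : f w = f v ↔ w = v := hinj.eq_iff hw hv
      simp [h1, h2, h3]
  have hgrow : ∀ S, P S → S ≠ univ → ∃ T, P T ∧ #S < #T := by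
    rintro S ⟨m, s, hS, hm, hs, hcl⟩ hSu
    obtain ⟨u, hu⟩ : S.Nonempty := by rw [← card_pos]; omega
    obtain ⟨v, hv⟩ : ∃ v, v ∉ S := by
      by_contra! h
      exact hSu (eq_univ_of_forall h)
    obtain ⟨p⟩ := hG.preconnected u v
    obtain ⟨d, _, hd1, hd2⟩ := p.exists_boundary_dart (S : Set V) hu hv
    have hadj := d.adj
    generalize d.fst = u at hd1 hadj
    generalize d.snd = x at hd2 hadj
    rw [mem_coe] at hd1 hd2
    -- An edge of the matching disjoint from `S` keeps the invariant.
    have hedge {p : V} (hp : p ∉ I) (hpS : p ∉ S)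
        (hA : Assembly G (insert p (insert (f p) S)) (m + 1) s) :
        ∃ T, P T ∧ #S < #T := by
      have hfp : f p ∉ S := fun h => hpS ((hcl p hp).2 h)
      have hpf : p ∉ insert (f p) S := by simp [hpS, (hf p hp).2.ne]
      have hc : #(insert p (insert (f p) S)) = #S + 2 := by
        rw [card_insert_of_notMem hpf, card_insert_of_notMem hfp]
      refine ⟨_, ⟨m + 1, s, hA, ?_, by omega, ?_⟩, by omega⟩
      · rw [filter_insert, if_pos hp, filter_insert, if_neg (by simpa using (hf p hp).1),
          card_insert_of_notMem (by simp [hpS]), hm]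
      · intro w hw
        have h1 : w ≠ f p := fun h => hw (h ▸ (hf p hp).1)
        have h2 : f w ≠ p := fun h => hp (h ▸ (hf w hw).1)
        have h3 : f w = f p ↔ w = p := hinj.eq_iff hw hp
        simp [h1, h2, h3, hcl w hw]
    by_cases hxI : x ∈ I
    · by_cases hx : ∃ p, p ∉ I ∧ f p = x
      · obtain ⟨p, hp, rfl⟩ := hx
        have hpS : p ∉ S := fun h => hd2 ((hcl p hp).1 h)
        refine hedge hp hpS ?_
        rw [insert_comm]
        exact .pair hS hd1 hd2 hpS hadj (hf p hp).2.symm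
      · push Not at hx
        have hc := card_insert_of_notMem hd2
        refine ⟨insert x S, ⟨m, s + 1, .single hS hd1 hd2 hadj, ?_, by omega, ?_⟩, by omega⟩
        · rw [filter_insert, if_neg (by simpa using hxI), hm]
        · intro w hw
          have h1 : w ≠ x := fun h => hw (h ▸ hxI)
          simp [h1, hx w hw, hcl w hw]
    · exact hedge hxI hd2 (.pair hS hd1 hd2 (fun h => hd2 ((hcl x hxI).2 h)) hadj (hf x hxI).2)
  obtain ⟨S₀, hS₀⟩ := hbase
  obtain ⟨S, hS, hmaxS⟩ := exists_max_image (univ.filter P) card ⟨S₀, by simpa using hS₀⟩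
  have hSP : P S := (mem_filter.1 hS).2
  obtain rfl : S = univ := by
    by_contra h
    obtain ⟨T, hT, hlt⟩ := hgrow S hSP h
    exact absurd (hmaxS T (by simpa using hT)) (by omega)
  obtain ⟨m, s, hA, hm, hs, _⟩ := hSP
  exact ⟨m, s, hA, hm, by simpa using hs⟩

/-- A tree with at least two vertices is an assembly with `n - α - 1` attached edges. -/
lemma SimpleGraph.IsTree.exists_assembly_univ (hG : G.IsTree) (hV : 2 ≤ Fintype.card V) :
    ∃ m s, Assembly G univ m s ∧ G.indepNum + m + 1 = Fintype.card V ∧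
      Fintype.card V = 2 * m + 2 + s := by
  classical
  obtain ⟨C⟩ := hG.colorable_two
  obtain ⟨I, hI⟩ := G.exists_isNIndepSet_indepNum
  let C' : G.Coloring Bool := G.recolorOfEquiv finTwoEquiv C
  obtain ⟨f, hinj, hf⟩ := exists_matching_into_indepSet C' hI.isIndepSet hI.card_eq
  have : Nontrivial V := Fintype.one_lt_card_iff_nontrivial.1 hV
  have hne : ∃ v, v ∉ I := by
    by_contra! h
    obtain ⟨v⟩ := hG.connected.nonempty
    obtain ⟨w, hvw⟩ := hG.connected.preconnected.exists_adj_of_nontrivial v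
    exact hI.isIndepSet (h v) (h w) hvw.ne hvw
  obtain ⟨m, s, hA, hm, hs⟩ := _root_.exists_assembly_univ hG.connected hinj hf hne
  refine ⟨m, s, hA, ?_, hs⟩
  have h1 := card_filter_add_card_filter_not (s := (univ : Finset V)) (fun v => v ∈ I)
  rw [filter_univ_mem, hI.card_eq, hm, card_univ] at h1
  omega

end Matching

/-! ### Spiders with legs of length one and two -/

section LeggedStar

/-- The spider with legs of length one and two whose first leg vertices are `A` and whose second leg
vertices are `B`. The center is `none`, and the second vertex `b` continues the leg of `g b`. It is
a spider when `g` is injective. -/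
def leggedStar {A B : Type*} (g : B → A) : SimpleGraph (Option (A ⊕ B)) where
  Adj
    | none, some (.inl _) => True
    | some (.inl _), none => True
    | some (.inl a), some (.inr b) => a = g b
    | some (.inr b), some (.inl a) => a = g b
    | _, _ => False
  symm := ⟨by rintro (_ | _ | _) (_ | _ | _) h <;> exact h⟩
  loopless := ⟨by rintro (_ | _ | _) h <;> exact h⟩

section

variable {A B : Type*} (g : B → A) (a a' : A) (b b' : B)

@[simp] lemma leggedStar_adj_none_inl : (leggedStar g).Adj none (some (.inl a)) := trivial

@[simp] lemma leggedStar_adj_inl_none : (leggedStar g).Adj (some (.inl a)) none := trivial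

@[simp] lemma leggedStar_not_adj_none_inr : ¬ (leggedStar g).Adj none (some (.inr b)) := id

@[simp] lemma leggedStar_not_adj_inr_none : ¬ (leggedStar g).Adj (some (.inr b)) none := id

@[simp] lemma leggedStar_not_adj_inl_inl :
    ¬ (leggedStar g).Adj (some (.inl a)) (some (.inl a')) := id

@[simp] lemma leggedStar_not_adj_inr_inr :
    ¬ (leggedStar g).Adj (some (.inr b)) (some (.inr b')) := id

@[simp] lemma leggedStar_adj_inl_inr :
    (leggedStar g).Adj (some (.inl a)) (some (.inr b)) ↔ a = g b := .rfl

@[simp] lemma leggedStar_adj_inr_inl :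
    (leggedStar g).Adj (some (.inr b)) (some (.inl a)) ↔ a = g b := .rfl

end

/-- An injection between finite types is determined by the two cardinalities up to bijections of
its source and of its target. -/
lemma exists_equiv_comp_eq {A B A' B' : Type*} [Finite A] [Finite B] [Finite A'] [Finite B']
    {g : B → A} {g' : B' → A'} (hg : g.Injective) (hg' : g'.Injective)
    (hA : Nat.card A = Nat.card A') (hB : Nat.card B = Nat.card B') :
    ∃ (eA : A ≃ A') (eB : B ≃ B'), ∀ b, eA (g b) = g' (eB b) := by
  classical
  let eB : B ≃ B' := (Finite.card_eq.1 hB).some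
  let e : A ≃ A' := (Finite.card_eq.1 hA).some
  have := Fintype.ofFinite A
  let e₁ : {x // x ∈ Set.range g} ≃ {x // x ∈ Set.range (e.symm ∘ g' ∘ eB)} :=
    (Equiv.ofInjective g hg).symm.trans
      (Equiv.ofInjective _ (e.symm.injective.comp (hg'.comp eB.injective)))
  refine ⟨e₁.extendSubtype.trans e, eB, fun b => ?_⟩
  have h : (Equiv.ofInjective g hg).symm ⟨g b, Set.mem_range_self b⟩ = b :=
    (Equiv.ofInjective g hg).symm_apply_apply b
  rw [Equiv.trans_apply, e₁.extendSubtype_apply_of_mem (g b) (Set.mem_range_self b),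
    Equiv.trans_apply, h, Equiv.ofInjective_apply]
  simp

lemma nonempty_leggedStar_iso {A B A' B' : Type*} [Finite A] [Finite B] [Finite A'] [Finite B']
    {g : B → A} {g' : B' → A'} (hg : g.Injective) (hg' : g'.Injective)
    (hA : Nat.card A = Nat.card A') (hB : Nat.card B = Nat.card B') :
    Nonempty (leggedStar g ≃g leggedStar g') := by
  obtain ⟨eA, eB, h⟩ := exists_equiv_comp_eq hg hg' hA hB
  refine ⟨⟨Equiv.optionCongr (Equiv.sumCongr eA eB), ?_⟩⟩
  rintro (_ | _ | _) (_ | _ | _) <;> simp [← h]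

variable {A B : Type*} [DecidableEq A] [DecidableEq B]

/-- Without the center, the legs of length two over `T` contribute a factor three each, and first
vertices of legs whose second vertex is absent a factor two each. -/
lemma indepCount_leggedStar_legs {g : B → A} (hg : g.Injective) (T : Finset B) (R : Finset A)
    (hR : ∀ b ∈ T, g b ∉ R) :
    indepCount (leggedStar g)
      ((T.image (fun b => some (.inl (g b))) ∪ T.image (fun b => some (.inr b))) ∪
        R.image (fun a => some (.inl a))) = 3 ^ #T * 2 ^ #R := by
  induction R using Finset.induction_on with
  | empty =>
    simp only [image_empty, union_empty, card_empty, pow_zero, mul_one]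
    clear hR
    induction T using Finset.induction_on with
    | empty => simp
    | insert b T hb ih =>
      rw [image_insert, image_insert, insert_union, union_insert,
        indepCount_insert_insert_of_not_adj, ih, card_insert_of_notMem hb, pow_succ, mul_comm]
      · simpa [hg.eq_iff] using hb
      · simpa using hb
      · simp
      · intro v hv
        simp only [mem_union, mem_image] at hv
        rcases hv with ⟨c, hc, rfl⟩ | ⟨c, hc, rfl⟩
        · simpa [hg.eq_iff] using ne_of_mem_of_not_mem hc hb
        · simpa [hg.eq_iff] using (ne_of_mem_of_not_mem hc hb).symm
  | insert a R ha ih =>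
    rw [image_insert, union_insert, indepCount_insert_of_not_adj, ih, card_insert_of_notMem ha]
    · ring
    · intro b hb h
      exact hR b hb (mem_insert_of_mem h)
    · have : ∀ b ∈ T, g b ≠ a := fun b hb h => hR b hb (h ▸ mem_insert_self _ _)
      simpa [ha] using this
    · intro v hv
      simp only [mem_union, mem_image] at hv
      rcases hv with (⟨c, hc, rfl⟩ | ⟨c, hc, rfl⟩) | ⟨c, hc, rfl⟩
      · simp
      · have : g c ≠ a := fun h => hR c hc (h ▸ mem_insert_self _ _)
        simpa using this.symm
      · simp

lemma indepCount_leggedStar_image_inr (g : B → A) (T : Finset B) :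
    indepCount (leggedStar g) (T.image fun b => some (.inr b)) = 2 ^ #T := by
  induction T using Finset.induction_on with
  | empty => simp
  | insert b T hb ih =>
    rw [image_insert, indepCount_insert_of_not_adj, ih, card_insert_of_notMem hb, pow_succ,
      mul_comm]
    · simpa using hb
    · intro v hv
      obtain ⟨c, _, rfl⟩ := mem_image.1 hv
      simp

variable [Fintype A] [Fintype B]

lemma indepCount_leggedStar_erase_none {g : B → A} (hg : g.Injective) :
    indepCount (leggedStar g) (univ.erase none) =
      3 ^ Fintype.card B * 2 ^ (Fintype.card A - Fintype.card B) := by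
  have := indepCount_leggedStar_legs hg univ (univ.image g)ᶜ (by simp)
  rw [card_compl, card_image_of_injective _ hg, card_univ] at this
  rw [← this]
  congr 1
  ext v
  rcases v with _ | a | b <;> simp [-not_exists, em]

lemma fibonacciIndex_leggedStar {g : B → A} (hg : g.Injective) :
    fibonacciIndex (leggedStar g) =
      3 ^ Fintype.card B * 2 ^ (Fintype.card A - Fintype.card B) + 2 ^ Fintype.card B := by
  classical
  rw [fibonacciIndex_eq_indepCount_univ, ← insert_erase (mem_univ none),
    indepCount_insert _ (notMem_erase _ _), indepCount_leggedStar_erase_none hg,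
    ← card_univ (α := B), ← indepCount_leggedStar_image_inr g]
  congr 2
  ext v
  rcases v with _ | a | b <;> simp

end LeggedStar

/-! ### Recognizing spiders -/

section Recognition

variable {V : Type*} [Fintype V] [DecidableEq V] {G : SimpleGraph V}

/-- A connected bipartite graph in which the vertices other than `c` have at most one neighbor
other than `c` is a spider with center `c`. -/
lemma exists_iso_leggedStar (hG : G.Connected) (C : G.Coloring Bool) {c : V}
    (hc : SparseOn G (univ.erase c)) :
    ∃ (A B : Finset V) (g : B → A) (e : leggedStar g ≃g G), g.Injective ∧ e none = c := by
  classical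
  have hsp : ∀ v w w', v ≠ c → w ≠ c → w' ≠ c → G.Adj v w → G.Adj v w' → w = w' :=
    fun v w w' hv hw hw' => hc v (by simp [hv]) w (by simp [hw]) w' (by simp [hw'])
  -- The neighbors of `c` and their neighbors exhaust the vertices, by connectedness.
  have hcover : ∀ v, v = c ∨ G.Adj c v ∨ ∃ w, G.Adj c w ∧ G.Adj w v := by
    intro v
    by_contra hv
    obtain ⟨p⟩ := hG.preconnected c v
    obtain ⟨d, _, hd1, hd2⟩ := p.exists_boundary_dart
      {v | v = c ∨ G.Adj c v ∨ ∃ w, G.Adj c w ∧ G.Adj w v} (Or.inl rfl) hv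
    have hadj := d.adj
    generalize d.fst = x at hd1 hadj
    generalize d.snd = y at hd2 hadj
    rcases hd1 with rfl | hx | ⟨w, hcw, hwx⟩
    · exact hd2 (Or.inr (Or.inl hadj))
    · exact hd2 (Or.inr (Or.inr ⟨x, hx, hadj⟩))
    · have hy : y ≠ c := fun h => hd2 (Or.inl h)
      by_cases hxc : x = c
      · exact hd2 (Or.inr (Or.inl (hxc ▸ hadj)))
      · exact hd2 (Or.inr (Or.inl (hsp x w y hxc hcw.ne' hy hwx.symm hadj ▸ hcw)))
  have htri : ∀ v w, G.Adj c v → G.Adj c w → ¬ G.Adj v w := by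
    intro v w hv hw hvw
    have h1 := C.valid hv
    have h2 := C.valid hw
    have h3 := C.valid hvw
    revert h1 h2 h3
    cases C c <;> cases C v <;> cases C w <;> simp
  let A : Finset V := univ.filter fun v => G.Adj c v
  let B : Finset V := univ.filter fun v => v ≠ c ∧ ¬ G.Adj c v
  have hA (a : A) : G.Adj c a := (mem_filter.1 a.2).2
  have hB (b : B) : (b : V) ≠ c ∧ ¬ G.Adj c b := (mem_filter.1 b.2).2
  have hfoot : ∀ b : B, ∃ a : A, G.Adj a b := by
    intro b
    rcases hcover b with h | h | ⟨w, h1, h2⟩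
    · exact absurd h (hB b).1
    · exact absurd h (hB b).2
    · exact ⟨⟨w, by simpa [A] using h1⟩, h2⟩
  choose g hg using hfoot
  have hgu (a : A) (b : B) : G.Adj a b ↔ a = g b := by
    refine ⟨fun h => Subtype.ext ?_, fun h => h ▸ hg b⟩
    exact hsp b _ _ (hB b).1 (hA a).ne' (hA (g b)).ne' h.symm (hg b).symm
  have hinj : g.Injective := by
    intro b b' h
    refine Subtype.ext ?_
    exact hsp (g b) _ _ (hA (g b)).ne' (hB b).1 (hB b').1 (hg b) (h ▸ hg b')
  let φ : Option (A ⊕ B) → V := fun o => o.elim c (Sum.elim (fun a => a) (fun b => b))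
  have hφ : φ.Bijective := by
    constructor
    · rintro (_ | a | b) (_ | a' | b') h <;> simp only [φ, Option.elim, Sum.elim_inl,
        Sum.elim_inr] at h
      · rfl
      · exact absurd h (hA a').ne
      · exact absurd h.symm (hB b').1
      · exact absurd h.symm (hA a).ne
      · rw [Subtype.ext h]
      · exact absurd (h ▸ hA a) (hB b').2
      · exact absurd h (hB b).1
      · exact absurd (h ▸ hA a') (hB b).2
      · rw [Subtype.ext h]
    · intro v
      by_cases h1 : v = c
      · exact ⟨none, h1.symm⟩
      by_cases h2 : G.Adj c v
      · exact ⟨some (.inl ⟨v, by simpa [A] using h2⟩), rfl⟩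
      · exact ⟨some (.inr ⟨v, by simpa [B] using ⟨h1, h2⟩⟩), rfl⟩
  have hBB (b b' : B) : ¬ G.Adj b b' := by
    intro h
    have := hsp b _ _ (hB b).1 (hB b').1 (hA (g b)).ne' h (hg b).symm
    exact (hB b').2 (this ▸ hA (g b))
  refine ⟨A, B, g, ⟨Equiv.ofBijective φ hφ, ?_⟩, hinj, rfl⟩
  rintro (_ | a | b) (_ | a' | b') <;>
    simp only [φ, Equiv.ofBijective_apply, Option.elim, Sum.elim_inl, Sum.elim_inr]
  · simp
  · simp [hA a']
  · simp [(hB b').2]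
  · simp [(hA a).symm]
  · simpa using htri _ _ (hA a) (hA a')
  · simpa using hgu a b'
  · simpa using fun h => (hB b).2 h.symm
  · simpa [G.adj_comm] using hgu a' b
  · simpa using hBB b b'

end Recognition

/-! ### The Turán-connected graph and the spider -/

section Models

/-- The vertices of `turanConnected n a` are `0`, its neighbors `1, …, a`, and the remaining
vertices `a + 1 + j`, each of which is joined to `j + 1` only. -/
lemma nonempty_leggedStar_iso_turanConnected {n a : ℕ} (h1 : n ≤ 2 * a) (h2 : a + 1 ≤ n) :
    Nonempty (leggedStar (Fin.castLE (show n - a - 1 ≤ a by omega)) ≃g turanConnected n a) := by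
  let φ : Option (Fin a ⊕ Fin (n - a - 1)) → Fin n := fun o => o.elim ⟨0, by omega⟩
    (Sum.elim (fun i => ⟨i + 1, by omega⟩) (fun j => ⟨a + 1 + j, by omega⟩))
  have hφ : φ.Bijective := by
    refine (Fintype.bijective_iff_injective_and_card φ).2 ⟨?_, by simp; omega⟩
    rintro (_ | i | j) (_ | i' | j') h <;>
      simp only [φ, Option.elim, Sum.elim_inl, Sum.elim_inr, Fin.mk.injEq] at h <;>
      simp [Fin.ext_iff] <;> omega
  have hadj (v w : Fin n) : (turanConnected n a).Adj v w ↔ v.val ≠ w.val ∧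
      (v.val % a = w.val % a ∨ (v.val = 0 ∧ w.val < a) ∨ (w.val = 0 ∧ v.val < a)) := by
    simp only [turanConnected, turanCliques, SimpleGraph.sup_adj, SimpleGraph.compl_adj,
      SimpleGraph.turanGraph_adj, SimpleGraph.fromRel_adj, ne_eq, Fin.ext_iff, not_not]
    tauto
  have hmod (i : Fin a) : ((i : ℕ) + 1) % a = if (i : ℕ) + 1 = a then 0 else (i : ℕ) + 1 := by
    split_ifs with h
    · rw [h, Nat.mod_self]
    · exact Nat.mod_eq_of_lt (by omega)
  have hmod' (j : Fin (n - a - 1)) : (a + 1 + (j : ℕ)) % a = (j : ℕ) + 1 := by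
    rw [add_assoc, Nat.add_mod_left, Nat.mod_eq_of_lt (by omega), add_comm]
  refine ⟨⟨Equiv.ofBijective φ hφ, ?_⟩⟩
  rintro (_ | i | j) (_ | i' | j') <;>
    simp only [Equiv.ofBijective_apply, hadj, φ, Option.elim, Sum.elim_inl, Sum.elim_inr,
      Nat.zero_mod, hmod, hmod',
      leggedStar_adj_none_inl, leggedStar_adj_inl_none, leggedStar_not_adj_none_inr,
      leggedStar_not_adj_inr_none, leggedStar_not_adj_inl_inl, leggedStar_not_adj_inr_inr,
      leggedStar_adj_inl_inr, leggedStar_adj_inr_inl, SimpleGraph.irrefl, Fin.ext_iff,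
      Fin.val_castLE, iff_true, iff_false] <;>
    (try split_ifs) <;> grind

lemma spider_adj_none_some {k : ℕ} {l : Fin k → ℕ} (i : Fin k) (j : Fin (l i)) :
    (spider l).Adj none (some ⟨i, j⟩) ↔ j.val = 0 := by
  simp only [spider, SimpleGraph.fromRel_adj]
  constructor
  · rintro ⟨-, (⟨-, i', j', h, h0⟩ | ⟨i', j', j'', h, -⟩) | ⟨h, -⟩ | ⟨i', j', j'', -, h, -⟩⟩
    · cases h
      exact h0
    all_goals cases h
  · exact fun h => ⟨by simp, Or.inl (Or.inl ⟨trivial, i, j, rfl, h⟩)⟩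

lemma spider_adj_some_some {k : ℕ} {l : Fin k → ℕ} (i i' : Fin k) (j : Fin (l i))
    (j' : Fin (l i')) : (spider l).Adj (some ⟨i, j⟩) (some ⟨i', j'⟩) ↔
      i = i' ∧ (j'.val = j.val + 1 ∨ j.val = j'.val + 1) := by
  simp only [spider, SimpleGraph.fromRel_adj]
  constructor
  · rintro ⟨-, (⟨h, -⟩ | ⟨i', j', j'', h, h', h0⟩) | ⟨h, -⟩ | ⟨i', j', j'', h, h', h0⟩⟩
    · cases h
    · cases h
      cases h'
      exact ⟨rfl, Or.inl h0⟩
    · cases h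
    · cases h
      cases h'
      exact ⟨rfl, Or.inr h0⟩
  · rintro ⟨rfl, h | h⟩
    · refine ⟨?_, Or.inl (Or.inr ⟨i, j, j', rfl, rfl, h⟩)⟩
      intro he
      cases he
      omega
    · refine ⟨?_, Or.inr (Or.inr ⟨i, j', j, rfl, rfl, h⟩)⟩
      intro he
      cases he
      omega

lemma nonempty_leggedStar_iso_spider {k a : ℕ} (hk : k ≤ a) {l : Fin a → ℕ}
    (hl : ∀ i, l i = if i.val < k then 2 else 1) :
    Nonempty (leggedStar (Fin.castLE hk) ≃g spider l) := by
  have hl1 (i : Fin a) : 0 < l i := by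
    rw [hl]
    split_ifs <;> omega
  have hl2 (j : Fin k) : 1 < l (j.castLE hk) := by
    rw [hl, if_pos (by simp)]
    omega
  let φ : Option (Fin a ⊕ Fin k) → Option (Σ i : Fin a, Fin (l i)) :=
    Option.map (Sum.elim (fun i => ⟨i, ⟨0, hl1 i⟩⟩) (fun j => ⟨j.castLE hk, ⟨1, hl2 j⟩⟩))
  have hφ : φ.Bijective := by
    constructor
    · intro o o' h
      have h' := congrArg (Option.map fun x : Σ i : Fin a, Fin (l i) => (x.1.val, x.2.val)) h
      rcases o with _ | i | j <;> rcases o' with _ | i' | j' <;>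
        simp [φ, ← Fin.ext_iff] at h' ⊢ <;> exact h'
    · rintro (_ | ⟨i, j, hj⟩)
      · exact ⟨none, rfl⟩
      · have hj2 : j = 0 ∨ (j = 1 ∧ i.val < k) := by
          have hj' := hj
          rw [hl] at hj'
          split_ifs at hj' <;> omega
        rcases hj2 with rfl | ⟨rfl, hi⟩
        · exact ⟨some (.inl i), rfl⟩
        · exact ⟨some (.inr ⟨i, hi⟩), rfl⟩
  refine ⟨⟨Equiv.ofBijective φ hφ, ?_⟩⟩
  rintro (_ | i | j) (_ | i' | j') <;>
    simp only [Equiv.ofBijective_apply, φ, Option.map_some, Option.map_none, Sum.elim_inl,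
      Sum.elim_inr, spider_adj_none_some, spider_adj_some_some,
      SimpleGraph.adj_comm _ (some _) none,
      leggedStar_adj_none_inl, leggedStar_not_adj_none_inr, leggedStar_not_adj_inl_inl,
      leggedStar_not_adj_inr_inr, leggedStar_adj_inl_inr, leggedStar_adj_inr_inl,
      SimpleGraph.irrefl, Fin.ext_iff, Fin.val_castLE] <;> grind

end Models

/-! ### Extremal trees -/

section Extremal

lemma fibonacciIndex_turanConnected {m s : ℕ} :
    fibonacciIndex (turanConnected (2 * m + 2 + s) (m + 1 + s)) = 3 ^ m * 2 ^ (s + 1) + 2 ^ m := by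
  obtain ⟨e⟩ := nonempty_leggedStar_iso_turanConnected (n := 2 * m + 2 + s) (a := m + 1 + s)
    (by omega) (by omega)
  rw [← fibonacciIndex_congr _ e, fibonacciIndex_leggedStar (Fin.castLE_injective _),
    Fintype.card_fin, Fintype.card_fin, show 2 * m + 2 + s - (m + 1 + s) - 1 = m by omega,
    show m + 1 + s - m = s + 1 by omega]

lemma three_pow_mul_two_pow_left_injective {a b c d : ℕ} (h : 3 ^ a * 2 ^ b = 3 ^ c * 2 ^ d) :
    a = c := by
  have h3 : Fact (Nat.Prime 3) := ⟨Nat.prime_three⟩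
  have hz (k : ℕ) : padicValNat 3 (2 ^ k) = 0 :=
    padicValNat.eq_zero_of_not_dvd fun hk => by
      have := Nat.prime_three.dvd_of_dvd_pow hk
      omega
  have := congrArg (padicValNat 3) h
  rwa [padicValNat.mul (by positivity) (by positivity), padicValNat.mul (by positivity)
    (by positivity), padicValNat.prime_pow, padicValNat.prime_pow, hz, hz] at this

/-- A vertex `c` whose deletion leaves an extremal graph is the center of a spider, and the number
of independent sets avoiding `c` determines the number `m` of legs of length two. -/
lemma nonempty_iso_turanConnected {V : Type*} [Fintype V] [DecidableEq V] {G : SimpleGraph V}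
    (hG : G.IsTree) {m s : ℕ} (hV : Fintype.card V = 2 * m + 2 + s) {c : V}
    (hc : SparseOn G (univ.erase c))
    (hcount : indepCount G (univ.erase c) = 3 ^ m * 2 ^ (s + 1)) :
    Nonempty (G ≃g turanConnected (2 * m + 2 + s) (m + 1 + s)) := by
  obtain ⟨C⟩ := hG.colorable_two
  obtain ⟨A, B, g, e, hg, he⟩ :=
    exists_iso_leggedStar hG.connected (G.recolorOfEquiv finTwoEquiv C) hc
  have hmap : (univ.erase none).map e.toEmbedding.toEmbedding = univ.erase c := by
    rw [map_erase, map_univ_equiv e.toEquiv]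
    exact congrArg _ he
  have hB := indepCount_map (leggedStar g) e.toEmbedding (univ.erase none)
  rw [hmap, hcount, indepCount_leggedStar_erase_none hg] at hB
  have hB := three_pow_mul_two_pow_left_injective hB
  have hcard := Fintype.card_congr e.toEquiv
  rw [Fintype.card_option, Fintype.card_sum, hV] at hcard
  obtain ⟨e₁⟩ := nonempty_leggedStar_iso_turanConnected (n := 2 * m + 2 + s) (a := m + 1 + s)
    (by omega) (by omega)
  obtain ⟨e₂⟩ := nonempty_leggedStar_iso hg
    (Fin.castLE_injective (show 2 * m + 2 + s - (m + 1 + s) - 1 ≤ m + 1 + s by omega))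
    (by rw [Nat.card_eq_fintype_card, Nat.card_fin]; omega)
    (by rw [Nat.card_eq_fintype_card, Nat.card_fin]; omega)
  exact ⟨e.symm.trans (e₂.trans e₁)⟩

end Extremal

theorem mainTheorem3 (n α : ℕ) (hn : 2 ≤ n) :
    (∀ (V : Type*) [Fintype V] (G : SimpleGraph V),
      G.IsTree → Fintype.card V = n → G.indepNum = α →
        (n ≤ 2 * α ∧ α + 1 ≤ n) ∧
        (fibonacciIndex G : ℚ) ≤
          3 ^ ((n : ℤ) - α - 1) * 2 ^ (2 * (α : ℤ) - n + 1) + 2 ^ ((n : ℤ) - α - 1) ∧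
        ((fibonacciIndex G : ℚ) =
            3 ^ ((n : ℤ) - α - 1) * 2 ^ (2 * (α : ℤ) - n + 1) + 2 ^ ((n : ℤ) - α - 1) ↔
          Nonempty (G ≃g turanConnected n α))) ∧
    (n ≤ 2 * α → α + 1 ≤ n →
      Nonempty (turanConnected n α ≃g
        spider (fun i : Fin α => if i.val < n - α - 1 then 2 else 1))) := by
  classical
  refine ⟨fun V _ G hG hV hα => ?_, fun h1 h2 => ?_⟩
  · obtain ⟨m, s, hA, hm, hs⟩ := hG.exists_assembly_univ (hV ▸ hn)
    obtain rfl : α = m + 1 + s := by omega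
    obtain rfl : n = 2 * m + 2 + s := by omega
    -- The exponents are natural numbers, so the bound is one between natural numbers.
    have hbound : (3 : ℚ) ^ (((2 * m + 2 + s : ℕ) : ℤ) - (m + 1 + s : ℕ) - 1) *
          2 ^ (2 * ((m + 1 + s : ℕ) : ℤ) - (2 * m + 2 + s : ℕ) + 1) +
          2 ^ (((2 * m + 2 + s : ℕ) : ℤ) - (m + 1 + s : ℕ) - 1) =
        ((3 ^ m * 2 ^ (s + 1) + 2 ^ m : ℕ) : ℚ) := by
      rw [show ((2 * m + 2 + s : ℕ) : ℤ) - (m + 1 + s : ℕ) - 1 = (m : ℕ) by push_cast; ring,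
        show 2 * ((m + 1 + s : ℕ) : ℤ) - (2 * m + 2 + s : ℕ) + 1 = (s + 1 : ℕ) by push_cast; ring]
      simp only [zpow_natCast]
      push_cast
      rfl
    have hle := hA.indepCount_le_add
    rw [← fibonacciIndex_eq_indepCount_univ] at hle
    rw [hbound, Nat.cast_le, Nat.cast_inj]
    refine ⟨by omega, hle.1, fun h => ?_, fun ⟨e⟩ => ?_⟩
    · obtain ⟨c, _, hc, hcount⟩ := hle.2 h
      exact nonempty_iso_turanConnected hG hs hc hcount
    · rw [fibonacciIndex_congr G e, fibonacciIndex_turanConnected]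
  · obtain ⟨e₁⟩ := nonempty_leggedStar_iso_turanConnected h1 h2
    obtain ⟨e₂⟩ := nonempty_leggedStar_iso_spider
      (l := fun i : Fin α => if i.val < n - α - 1 then 2 else 1) (by omega) fun _ => rfl
    exact ⟨e₁.symm.trans e₂⟩
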